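/- Let $S=k[x_1,\dots,x_n]$ be a polynomial ring over a field $k$ with its standard grading. Every finitely generated $\mathbb{Z}$-graded $S$-module $M$ has a minimal graded free resolution $F_\bullet$, with $F_i=\bigoplus_j S(-j)^{\beta_{i,j}(M)}$; write $$T_i(M)=\max\{j : \beta_{i,j}(M)\neq 0\},\qquad t_i(M)=\min\{j : \beta_{i,j}(M)\neq 0\}.$$ (1) Let $M\neq 0$ be a finitely generated graded $S$-module with projective dimension $p=\operatorname{pd}_S(M)$, and let $f\in\operatorname{Ann}_S(M)$ be a nonzero homogeneous polynomial of degree $d$. Then $p\ge 1$, the numbers $T_p(M)$, $T_{p-1}(M)$ and $T_1(S/(f))$ are well defined (each is the maximum of a nonempty, bounded set), and $$T_p(M)\le T_{p-1}(M)+d=T_{p-1}(M)+T_1(S/(f)).$$ (2) In particular, let $I$ be a homogeneous ideal of $S$ with $I\neq 0$ and $I\neq S$, and let $p=\operatorname{pd}_S(S/I)$. Then $p\ge 1$, the numbers $T_p(S/I)$, $T_{p-1}(S/I)$ and $t_1(S/I)$ are well defined, and $$T_p(S/I)\le T_{p-1}(S/I)+t_1(S/I).$$ -/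

import Mathlib

open CategoryTheory

universe u

namespace GradedSyzygies

section

variable {k : Type u} [Field k] {n : ℕ}

/-- The standard grading of the polynomial ring `S = k[x₁, …, xₙ]`, indexed by `ℤ`
(zero in negative degrees). -/
noncomputable def polyGrading (k : Type u) [Field k] (n : ℕ) : ℤ → AddSubgroup (MvPolynomial (Fin n) k)
  | Int.ofNat d => (MvPolynomial.homogeneousSubmodule (Fin n) k d).toAddSubgroup
  | Int.negSucc _ => ⊥

/-- The degree `j` part of the graded free module `⨁ₐ S(-deg a)`: the vectors whose `a`-th
coordinate is homogeneous of degree `j - deg a`. -/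
noncomputable def freeGrading (k : Type u) [Field k] (n : ℕ) {r : ℕ} (deg : Fin r → ℤ) (j : ℤ) :
    AddSubgroup (Fin r → MvPolynomial (Fin n) k) :=
  AddSubgroup.pi Set.univ fun a => polyGrading k n (j - deg a)

/-- The grading of `S ⧸ I` induced by the grading of `S`. -/
noncomputable def quotientGrading (I : Ideal (MvPolynomial (Fin n) k)) (j : ℤ) :
    AddSubgroup (MvPolynomial (Fin n) k ⧸ I) :=
  (polyGrading k n j).map (Ideal.Quotient.mk I).toAddMonoidHom

/-- A minimal graded free resolution `⋯ → F₂ → F₁ → F₀ → M → 0` of a graded module `M` by graded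
free modules `F i = ⨁ₐ S(-deg i a)` of finite rank, with degree-preserving maps. -/
structure MinimalGradedFreeResolution {M : Type u} [AddCommGroup M]
    [Module (MvPolynomial (Fin n) k) M] (𝓜 : ℤ → AddSubgroup M) where
  /-- the rank of `F i` -/
  rank : ℕ → ℕ
  /-- the degrees of the basis elements of `F i` -/
  deg : (i : ℕ) → Fin (rank i) → ℤ
  /-- the differential `F (i + 1) → F i` -/
  d : (i : ℕ) → (Fin (rank (i + 1)) → MvPolynomial (Fin n) k) →ₗ[MvPolynomial (Fin n) k]
    (Fin (rank i) → MvPolynomial (Fin n) k)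
  /-- the augmentation `F 0 → M` -/
  aug : (Fin (rank 0) → MvPolynomial (Fin n) k) →ₗ[MvPolynomial (Fin n) k] M
  d_mem : ∀ (i : ℕ) (j : ℤ), ∀ v ∈ freeGrading k n (deg (i + 1)) j,
    d i v ∈ freeGrading k n (deg i) j
  aug_mem : ∀ j : ℤ, ∀ v ∈ freeGrading k n (deg 0) j, aug v ∈ 𝓜 j
  aug_surjective : Function.Surjective aug
  exact_zero : Function.Exact (d 0) aug
  exact_succ : ∀ i : ℕ, Function.Exact (d (i + 1)) (d i)
  minimal : ∀ i : ℕ, LinearMap.range (d i) ≤ MvPolynomial.idealOfVars (Fin n) k • ⊤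

/-- The set `{j | β_{i,j}(M) ≠ 0}` of graded shifts in homological degree `i`: the `j` for which
`S(-j)` is a summand of the `i`-th module of the minimal graded free resolution of `M`. -/
def gradedShifts (k : Type u) [Field k] (n : ℕ) {M : Type u} [AddCommGroup M]
    [Module (MvPolynomial (Fin n) k) M] (𝓜 : ℤ → AddSubgroup M) (i : ℕ) : Set ℤ :=
  {j | ∃ (F : MinimalGradedFreeResolution (k := k) (n := n) 𝓜) (a : Fin (F.rank i)),
    F.deg i a = j}

/-- The maximal graded shift `T_i(M)`. -/
noncomputable def maxShift (k : Type u) [Field k] (n : ℕ) {M : Type u} [AddCommGroup M]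
    [Module (MvPolynomial (Fin n) k) M] (𝓜 : ℤ → AddSubgroup M) (i : ℕ) : ℤ :=
  sSup (gradedShifts k n 𝓜 i)

/-- The minimal graded shift `t_i(M)`. -/
noncomputable def minShift (k : Type u) [Field k] (n : ℕ) {M : Type u} [AddCommGroup M]
    [Module (MvPolynomial (Fin n) k) M] (𝓜 : ℤ → AddSubgroup M) (i : ℕ) : ℤ :=
  sInf (gradedShifts k n 𝓜 i)

end

end GradedSyzygies

attribute [local instance] MvPolynomial.gradedAlgebra

/-!
Let `F` be a minimal graded free resolution of `M`, let `p = pd M` and let `f ∈ Ann M` be a nonzero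
form of degree `d`. Multiplication by `f` is zero on `M`, hence null-homotopic on `F` by maps
`s : F i → F (i + 1)` of degree `d` (`exists_homotopy`). Minimality makes `p` the length of `F`:
the `p`-th syzygy module, the image of `F p` in `F (p - 1)`, is projective, so its minimal cover
`F p` maps to it injectively by Nakayama (`d_injective_of_projective`). On `F p` the
homotopy relation therefore reads `s ∘ d = f`. For a basis element `e` of `F p` of maximal degree
the coefficient of `e` in `s (d e)` is `f ≠ 0`, so some basis element `b` of `F (p - 1)` has
`s b` with a nonzero coefficient at `e`, which forces `deg e ≤ deg b + d` (`exists_deg_le`).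

The shifts are defined through all minimal graded free resolutions, so one also needs that such a
resolution exists (`nonempty_minimalGradedFreeResolution`, by covering syzygies with homogeneous
generating sets of minimal cardinality) and that any two have the same degrees
(`gradedShifts_eq`). For the latter, comparison maps `φ`, `ψ` satisfy `ψ ∘ φ ≡ 1` modulo `𝔪`, so a
basis element `e` has some `b` for which the `b`-coefficient of `φ e` and the `e`-coefficient of
`ψ b` are both units, hence of degree zero. Existence of the maxima and minima is then finiteness
of the rank.

For a proper homogeneous ideal `I`, the resolution of `S ⧸ I` can be chosen with `F 0 = S`, and
`F 1` is a minimal cover of `I` (`exists_resolution_quotient`). This computes the shifts of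
`S ⧸ (f)` in homological degree one, and shows that `t₁(S ⧸ I)` is the degree of a nonzero form in
`I`, to which the general bound applies.
-/

namespace GradedSyzygies

/-! ### Homogeneous components -/

section Internal

variable {ι M : Type*} [DecidableEq ι] [AddCommGroup M]

/-- A family of subgroups that generates `M` and admits a compatible family of additive
projections is an internal direct sum decomposition. -/
theorem isInternal_of_projections (𝓐 : ι → AddSubgroup M) (π : ι → M →+ M)
    (hself : ∀ i, ∀ x ∈ 𝓐 i, π i x = x) (hne : ∀ i j, i ≠ j → ∀ x ∈ 𝓐 i, π j x = 0)
    (htop : ∀ x, x ∈ ⨆ i, 𝓐 i) : DirectSum.IsInternal 𝓐 := by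
  classical
  have key : ∀ (j : ι) (z : DirectSum ι fun i => 𝓐 i),
      π j (DirectSum.coeAddMonoidHom 𝓐 z) = z j := by
    intro j z
    induction z using DirectSum.induction_on with
    | zero => simp
    | of i x =>
      rw [DirectSum.coeAddMonoidHom_of]
      by_cases h : i = j
      · subst h
        rw [hself i x x.2, DirectSum.of_eq_same]
      · rw [hne i j h x x.2, DirectSum.of_eq_of_ne _ _ _ (Ne.symm h)]
        rfl
    | add x y hx hy => rw [map_add, map_add, hx, hy, DirectSum.add_apply, AddSubgroup.coe_add]
  refine ⟨(injective_iff_map_eq_zero _).2 fun z hz => ?_, fun x => ?_⟩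
  · ext j
    rw [← key, hz, map_zero]
    rfl
  · refine AddSubgroup.iSup_induction 𝓐 (C := fun x => ∃ z, DirectSum.coeAddMonoidHom 𝓐 z = x)
      (htop x) (fun i x hx => ?_) ⟨0, map_zero _⟩ fun x y hx hy => ?_
    · exact ⟨DirectSum.of _ i ⟨x, hx⟩, DirectSum.coeAddMonoidHom_of 𝓐 i ⟨x, hx⟩⟩
    · obtain ⟨a, rfl⟩ := hx
      obtain ⟨b, rfl⟩ := hy
      exact ⟨a + b, map_add _ _ _⟩

open DirectSum in
theorem decompose_map {N : Type*} [AddCommGroup N] {𝓐 : ι → AddSubgroup M}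
    {𝓑 : ι → AddSubgroup N} [Decomposition 𝓐] [Decomposition 𝓑] (φ : M →+ N)
    (hφ : ∀ j, ∀ x ∈ 𝓐 j, φ x ∈ 𝓑 j) (x : M) (j : ι) :
    (decompose 𝓑 (φ x) j : N) = φ (decompose 𝓐 x j) := by
  induction x using Decomposition.inductionOn 𝓐 with
  | zero => simp
  | @homogeneous i m =>
    by_cases h : i = j
    · subst h
      rw [decompose_of_mem_same _ (hφ _ _ m.2), decompose_of_mem_same _ m.2]
    · rw [decompose_of_mem_ne _ (hφ _ _ m.2) h, decompose_of_mem_ne _ m.2 h, map_zero]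
  | add x y hx hy => simp [hx, hy]

end Internal

section Poly

variable {k : Type u} [Field k] {n : ℕ}

local notation "S" => MvPolynomial (Fin n) k

theorem mem_polyGrading_natCast {d : ℕ} {f : S} :
    f ∈ polyGrading k n (d : ℤ) ↔ f.IsHomogeneous d := Iff.rfl

theorem eq_zero_of_mem_polyGrading_neg {j : ℤ} (hj : j < 0) {f : S}
    (hf : f ∈ polyGrading k n j) : f = 0 := by
  cases j with
  | ofNat d => simp at hj; omega
  | negSucc d => exact hf

theorem one_mem_polyGrading : (1 : S) ∈ polyGrading k n 0 :=
  MvPolynomial.isHomogeneous_one _ _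

theorem mul_mem_polyGrading {i j : ℤ} {f g : S} (hf : f ∈ polyGrading k n i)
    (hg : g ∈ polyGrading k n j) : f * g ∈ polyGrading k n (i + j) := by
  rcases lt_or_ge i 0 with hi | hi
  · rw [eq_zero_of_mem_polyGrading_neg hi hf, zero_mul]
    exact zero_mem _
  rcases lt_or_ge j 0 with hj | hj
  · rw [eq_zero_of_mem_polyGrading_neg hj hg, mul_zero]
    exact zero_mem _
  lift i to ℕ using hi
  lift j to ℕ using hj
  rw [← Nat.cast_add]
  exact MvPolynomial.IsHomogeneous.mul hf hg

/-- The projection of a polynomial to its homogeneous component of degree `j : ℤ`. -/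
noncomputable def polyProj (k : Type u) [Field k] (n : ℕ) (j : ℤ) :
    MvPolynomial (Fin n) k →+ MvPolynomial (Fin n) k :=
  if 0 ≤ j then (MvPolynomial.homogeneousComponent j.toNat).toAddMonoidHom else 0

theorem polyProj_natCast (d : ℕ) (f : S) :
    polyProj k n d f = MvPolynomial.homogeneousComponent d f := by
  simp [polyProj]

theorem polyProj_of_mem {j : ℤ} {f : S} (hf : f ∈ polyGrading k n j) : polyProj k n j f = f := by
  rcases lt_or_ge j 0 with hj | hj
  · rw [eq_zero_of_mem_polyGrading_neg hj hf, map_zero]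
  lift j to ℕ using hj
  rw [polyProj_natCast, MvPolynomial.homogeneousComponent_eq_self hf]

theorem polyProj_of_mem_ne {i j : ℤ} (hij : i ≠ j) {f : S} (hf : f ∈ polyGrading k n i) :
    polyProj k n j f = 0 := by
  rcases lt_or_ge i 0 with hi | hi
  · rw [eq_zero_of_mem_polyGrading_neg hi hf, map_zero]
  rcases lt_or_ge j 0 with hj | hj
  · simp [polyProj, not_le.2 hj]
  lift j to ℕ using hj
  lift i to ℕ using hi
  rw [polyProj_natCast, MvPolynomial.homogeneousComponent_of_mem hf, if_neg (by omega)]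

theorem mem_iSup_polyGrading_map {A : Type*} [AddCommGroup A] (φ : S →+ A) (f : S)
    {𝓐 : ℤ → AddSubgroup A} (c : ℤ)
    (h : ∀ (j : ℤ), ∀ g ∈ polyGrading k n j, φ g ∈ 𝓐 (j + c)) : φ f ∈ ⨆ j, 𝓐 j := by
  rw [← MvPolynomial.sum_homogeneousComponent f, map_sum]
  exact sum_mem fun d _ => AddSubgroup.mem_iSup_of_mem ((d : ℤ) + c)
    (h d _ (MvPolynomial.homogeneousComponent_isHomogeneous d f))

theorem polyGrading_isInternal : DirectSum.IsInternal (polyGrading k n) :=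
  isInternal_of_projections _ (polyProj k n) (fun _ _ => polyProj_of_mem)
    (fun _ _ hij _ => polyProj_of_mem_ne hij) fun f =>
      mem_iSup_polyGrading_map (AddMonoidHom.id _) f 0 fun j g hg => by simpa using hg

theorem mem_idealOfVars_iff {f : S} :
    f ∈ MvPolynomial.idealOfVars (Fin n) k ↔ MvPolynomial.constantCoeff f = 0 := by
  rw [← pow_one (MvPolynomial.idealOfVars (Fin n) k), MvPolynomial.mem_pow_idealOfVars_iff']
  simp [MvPolynomial.constantCoeff_eq, Finsupp.degree_eq_zero_iff]

theorem mem_smul_top_iff {r : ℕ} {I : Ideal S} {v : Fin r → S} :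
    v ∈ I • (⊤ : Submodule S (Fin r → S)) ↔ ∀ a, v a ∈ I := by
  constructor
  · intro h a
    induction h using Submodule.smul_induction_on' with
    | smul c hc w _ => exact I.mul_mem_right _ hc
    | add x _ y _ hx hy => exact I.add_mem hx hy
  · intro h
    rw [pi_eq_sum_univ' v]
    exact sum_mem fun a _ => Submodule.smul_mem_smul (h a) trivial

theorem mem_idealOfVars_smul_top_iff {r : ℕ} {v : Fin r → S} :
    v ∈ MvPolynomial.idealOfVars (Fin n) k • (⊤ : Submodule S (Fin r → S)) ↔
      ∀ a, MvPolynomial.constantCoeff (v a) = 0 := by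
  simp_rw [mem_smul_top_iff, mem_idealOfVars_iff]

/-- A homogeneous polynomial with nonzero constant coefficient has degree zero. -/
theorem eq_zero_of_constantCoeff_ne_zero {j : ℤ} {f : S} (hf : f ∈ polyGrading k n j)
    (h : MvPolynomial.constantCoeff f ≠ 0) : j = 0 := by
  rcases lt_or_ge j 0 with hj | hj
  · exact absurd (by rw [eq_zero_of_mem_polyGrading_neg hj hf, map_zero]) h
  lift j to ℕ using hj
  have : j = 0 := by
    by_contra hne
    exact h (MvPolynomial.IsHomogeneous.coeff_eq_zero hf (by simpa using Ne.symm hne))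
  simp [this]

theorem constantCoeff_eq_of_mem_zero {f : S} (hf : f ∈ polyGrading k n 0) :
    f = MvPolynomial.C (MvPolynomial.constantCoeff f) :=
  MvPolynomial.totalDegree_eq_zero_iff_eq_C.1
    (MvPolynomial.IsHomogeneous.totalDegree_le (n := 0) hf |>.antisymm (Nat.zero_le _))

end Poly

section Free

variable {k : Type u} [Field k] {n r : ℕ}

local notation "S" => MvPolynomial (Fin n) k

theorem mem_freeGrading {deg : Fin r → ℤ} {j : ℤ} {v : Fin r → S} :
    v ∈ freeGrading k n deg j ↔ ∀ a, v a ∈ polyGrading k n (j - deg a) := by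
  simp [freeGrading, AddSubgroup.mem_pi]

theorem single_mem_freeGrading (deg : Fin r → ℤ) (a : Fin r) {i j : ℤ} {f : S}
    (hf : f ∈ polyGrading k n i) (hij : i + deg a = j) :
    Pi.single a f ∈ freeGrading k n deg j := by
  rw [mem_freeGrading]
  intro b
  by_cases h : b = a
  · subst h
    rwa [Pi.single_eq_same, ← hij, add_sub_cancel_right]
  · rw [Pi.single_eq_of_ne h]
    exact zero_mem _

theorem single_one_mem_freeGrading (deg : Fin r → ℤ) (a : Fin r) :
    Pi.single a (1 : S) ∈ freeGrading k n deg (deg a) :=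
  single_mem_freeGrading deg a one_mem_polyGrading (zero_add _)

theorem freeGrading_isInternal (deg : Fin r → ℤ) :
    DirectSum.IsInternal (freeGrading k n deg) := by
  refine isInternal_of_projections _
    (fun j => AddMonoidHom.pi fun a => (polyProj k n (j - deg a)).comp (Pi.evalAddMonoidHom _ a))
    (fun j v hv => ?_) (fun i j hij v hv => ?_) (fun v => ?_)
  · ext1 a
    exact polyProj_of_mem (mem_freeGrading.1 hv a)
  · ext1 a
    exact polyProj_of_mem_ne (by omega) (mem_freeGrading.1 hv a)
  · rw [← Finset.univ_sum_single v]
    exact sum_mem fun a _ => mem_iSup_polyGrading_map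
      (AddMonoidHom.single (fun _ : Fin r => MvPolynomial (Fin n) k) a) (v a) (deg a)
      fun j g hg => single_mem_freeGrading deg a hg rfl

noncomputable instance freeDecomposition (deg : Fin r → ℤ) :
    DirectSum.Decomposition (freeGrading k n deg) :=
  (freeGrading_isInternal deg).chooseDecomposition

instance freeGradedSMul (deg : Fin r → ℤ) :
    SetLike.GradedSMul (polyGrading k n) (freeGrading k n deg) where
  smul_mem {i j f v} hf hv := by
    rw [mem_freeGrading] at hv ⊢
    intro a
    rw [vadd_eq_add, add_sub_assoc]
    exact mul_mem_polyGrading hf (hv a)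

/-- The constant coefficient of the `a`-th coordinate of `v` sits in the homogeneous component of
degree `deg a`. -/
theorem constantCoeff_decompose (deg : Fin r → ℤ) (v : Fin r → S) (a : Fin r) :
    MvPolynomial.constantCoeff ((DirectSum.decompose (freeGrading k n deg) v (deg a) :
      Fin r → S) a) = MvPolynomial.constantCoeff (v a) := by
  induction v using DirectSum.Decomposition.inductionOn (freeGrading k n deg) with
  | zero => simp
  | @homogeneous i m =>
    by_cases h : i = deg a
    · subst h
      rw [DirectSum.decompose_of_mem_same _ m.2]
    · rw [DirectSum.decompose_of_mem_ne _ m.2 h]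
      by_contra hne
      have := eq_zero_of_constantCoeff_ne_zero (mem_freeGrading.1 m.2 a)
        (fun h0 => hne (by simp [h0]))
      omega
  | add x y hx hy => simp [hx, hy]

theorem linearCombination_mem {M : Type*} [AddCommGroup M] [Module S M] {𝓜 : ℤ → AddSubgroup M}
    [SetLike.GradedSMul (polyGrading k n) 𝓜] {deg : Fin r → ℤ} {g : Fin r → M}
    (hg : ∀ a, g a ∈ 𝓜 (deg a)) {j : ℤ} {v : Fin r → S} (hv : v ∈ freeGrading k n deg j) :
    Fintype.linearCombination S g v ∈ 𝓜 j := by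
  rw [Fintype.linearCombination_apply]
  refine sum_mem fun a _ => ?_
  have := SetLike.GradedSMul.smul_mem (mem_freeGrading.1 hv a) (hg a)
  rwa [vadd_eq_add, sub_add_cancel] at this

end Free

section Quotient

variable {k : Type u} [Field k] {n : ℕ}

local notation "S" => MvPolynomial (Fin n) k

instance quotientGradedSMul (I : Ideal S) :
    SetLike.GradedSMul (polyGrading k n) (quotientGrading I) where
  smul_mem {i j f x} hf hx := by
    obtain ⟨g, hg, rfl⟩ := hx
    exact ⟨f * g, mul_mem_polyGrading hf hg, rfl⟩

theorem polyProj_mem {I : Ideal S}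
    (hI : I.IsHomogeneous (MvPolynomial.homogeneousSubmodule (Fin n) k)) {f : S} (hf : f ∈ I)
    (j : ℤ) : polyProj k n j f ∈ I := by
  rcases lt_or_ge j 0 with hj | hj
  · simp [polyProj, not_le.2 hj]
  lift j to ℕ using hj
  rw [polyProj_natCast]
  exact MvPolynomial.homogeneousComponent_mem_of_mem hI hf _

theorem quotientGrading_isInternal {I : Ideal S}
    (hI : I.IsHomogeneous (MvPolynomial.homogeneousSubmodule (Fin n) k)) :
    DirectSum.IsInternal (quotientGrading I) := by
  refine isInternal_of_projections _
    (fun j => QuotientAddGroup.map I.toAddSubgroup I.toAddSubgroup (polyProj k n j)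
      fun f hf => polyProj_mem hI hf j) ?_ ?_ ?_
  · rintro j _ ⟨f, hf, rfl⟩
    exact congrArg (Ideal.Quotient.mk I) (polyProj_of_mem hf)
  · rintro i j hij _ ⟨f, hf, rfl⟩
    exact congrArg (Ideal.Quotient.mk I) (polyProj_of_mem_ne hij hf)
  · intro x
    obtain ⟨f, rfl⟩ := Ideal.Quotient.mk_surjective x
    exact mem_iSup_polyGrading_map (Ideal.Quotient.mk I).toAddMonoidHom f 0
      fun j g hg => ⟨g, by simpa using hg, rfl⟩

end Quotient

/-! ### Existence of minimal graded free resolutions -/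

section Cover

variable {k : Type u} [Field k] {n : ℕ}

local notation "S" => MvPolynomial (Fin n) k

variable {M : Type u} [AddCommGroup M] [Module (MvPolynomial (Fin n) k) M] {𝓜 : ℤ → AddSubgroup M}
  [DirectSum.Decomposition 𝓜]

theorem ker_isHomogeneous {N : Type*} [AddCommGroup N] [Module S N] {𝓝 : ℤ → AddSubgroup N}
    [DirectSum.Decomposition 𝓝] {φ : N →ₗ[S] M} (hφ : ∀ j, ∀ v ∈ 𝓝 j, φ v ∈ 𝓜 j) :
    DirectSum.SetLike.IsHomogeneous 𝓝 (LinearMap.ker φ) := by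
  intro j v hv
  rw [LinearMap.mem_ker] at hv ⊢
  have := decompose_map φ.toAddMonoidHom hφ v j
  simpa [hv] using this.symm

theorem exists_homogeneous_generators {K : Submodule S M} (hfg : K.FG)
    (hK : DirectSum.SetLike.IsHomogeneous 𝓜 K) :
    ∃ (r : ℕ) (deg : Fin r → ℤ) (g : Fin r → M),
      (∀ a, g a ∈ 𝓜 (deg a)) ∧ Submodule.span S (Set.range g) = K := by
  classical
  obtain ⟨s, hs⟩ := hfg
  let T : Finset (ℤ × M) := s.biUnion fun x =>
    (DirectSum.decompose 𝓜 x).support.image fun j => (j, (DirectSum.decompose 𝓜 x j : M))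
  have hT : ∀ t ∈ T, t.2 ∈ 𝓜 t.1 ∧ t.2 ∈ K := by
    intro t ht
    simp only [T, Finset.mem_biUnion, Finset.mem_image] at ht
    obtain ⟨x, hx, j, -, rfl⟩ := ht
    exact ⟨SetLike.coe_mem _, hK j (hs ▸ Submodule.subset_span hx)⟩
  let e := T.equivFin.symm
  refine ⟨T.card, fun a => (e a).1.1, fun a => (e a).1.2, fun a => (hT _ (e a).2).1,
    le_antisymm (Submodule.span_le.2 ?_) (hs ▸ Submodule.span_le.2 fun x hx => ?_)⟩
  · rintro _ ⟨a, rfl⟩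
    exact (hT _ (e a).2).2
  · rw [← DirectSum.sum_support_decompose 𝓜 x]
    refine sum_mem fun j hj => Submodule.subset_span ?_
    have ht : (j, (DirectSum.decompose 𝓜 x j : M)) ∈ T :=
      Finset.mem_biUnion.2 ⟨x, hx, Finset.mem_image_of_mem _ hj⟩
    exact ⟨e.symm ⟨_, ht⟩, by simp⟩

variable [SetLike.GradedSMul (polyGrading k n) 𝓜]

/-- A relation with a unit coefficient makes one of the generators superfluous. -/
theorem span_succAbove_eq {r : ℕ} {g : Fin (r + 1) → M} {w : Fin (r + 1) → S} {a : Fin (r + 1)}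
    (hw : Fintype.linearCombination S g w = 0) (ha : IsUnit (w a)) :
    Submodule.span S (Set.range (g ∘ a.succAbove)) = Submodule.span S (Set.range g) := by
  refine le_antisymm (Submodule.span_mono (Set.range_comp_subset_range _ _))
    (Submodule.span_le.2 ?_)
  rintro _ ⟨b, rfl⟩
  by_cases hb : b = a
  · subst hb
    rw [Fintype.linearCombination_apply, Fin.sum_univ_succAbove _ b] at hw
    have h : w b • g b ∈ Submodule.span S (Set.range (g ∘ b.succAbove)) := by
      rw [eq_neg_of_add_eq_zero_left hw]
      exact neg_mem (sum_mem fun c _ => Submodule.smul_mem _ _ (Submodule.subset_span ⟨c, rfl⟩))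
    exact (Submodule.smul_mem_iff_of_isUnit _ ha).1 h
  · obtain ⟨c, rfl⟩ := Fin.exists_succAbove_eq hb
    exact Submodule.subset_span ⟨c, rfl⟩

/-- Every finitely generated homogeneous submodule is the image of a graded free module under a
degree-preserving map whose kernel lies in `𝔪 F`. A homogeneous generating set of minimal
cardinality works: a relation outside `𝔪 F` has a homogeneous component with a unit
coefficient. -/
theorem exists_minimal_cover {K : Submodule S M} (hfg : K.FG)
    (hK : DirectSum.SetLike.IsHomogeneous 𝓜 K) :
    ∃ (r : ℕ) (deg : Fin r → ℤ) (φ : (Fin r → S) →ₗ[S] M),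
      (∀ j, ∀ v ∈ freeGrading k n deg j, φ v ∈ 𝓜 j) ∧ LinearMap.range φ = K ∧
      LinearMap.ker φ ≤ MvPolynomial.idealOfVars (Fin n) k • ⊤ := by
  classical
  have hex := exists_homogeneous_generators hfg hK
  obtain ⟨deg, g, hg, hspan⟩ := Nat.find_spec hex
  have hmin := fun r => Nat.find_min hex (m := r)
  revert deg g hmin
  generalize Nat.find hex = r
  intro deg g hg hspan hmin
  -- `g` is a homogeneous generating family of minimal length `r`
  have hφ : ∀ j, ∀ v ∈ freeGrading k n deg j, Fintype.linearCombination S g v ∈ 𝓜 j :=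
    fun j v hv => linearCombination_mem hg hv
  refine ⟨r, deg, Fintype.linearCombination S g, hφ,
    (Fintype.range_linearCombination S g).trans hspan, fun v hv => ?_⟩
  rw [mem_idealOfVars_smul_top_iff]
  intro a
  by_contra hne
  have hw := ker_isHomogeneous hφ (deg a) hv
  have hwa := mem_freeGrading.1
    (SetLike.coe_mem (DirectSum.decompose (freeGrading k n deg) v (deg a))) a
  rw [sub_self] at hwa
  have hunit : IsUnit ((DirectSum.decompose (freeGrading k n deg) v (deg a) : Fin r → S) a) := by
    rw [constantCoeff_eq_of_mem_zero hwa, constantCoeff_decompose]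
    exact (isUnit_iff_ne_zero.2 hne).map MvPolynomial.C
  cases r with
  | zero => exact a.elim0
  | succ r =>
    exact hmin r r.lt_succ_self ⟨deg ∘ a.succAbove, g ∘ a.succAbove, fun b => hg _,
      (span_succAbove_eq hw hunit).trans hspan⟩

end Cover

section Existence

variable (k : Type u) [Field k] (n : ℕ)

local notation "S" => MvPolynomial (Fin n) k

/-- A graded free module of finite rank together with a homogeneous submodule of `𝔪 F`: the
state of the inductive construction of a minimal resolution. The submodule is the module of
syzygies that the next step has to cover. -/
structure SyzygyStage where
  /-- the rank of the free module -/
  rank : ℕ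
  /-- the degrees of its basis elements -/
  deg : Fin rank → ℤ
  /-- the syzygies -/
  syz : Submodule (MvPolynomial (Fin n) k) (Fin rank → MvPolynomial (Fin n) k)
  isHomogeneous : DirectSum.SetLike.IsHomogeneous (freeGrading k n deg) syz
  le_smul_top : syz ≤ MvPolynomial.idealOfVars (Fin n) k • ⊤

variable {k n}

namespace SyzygyStage

theorem exists_cover (s : SyzygyStage k n) :
    ∃ (r : ℕ) (deg : Fin r → ℤ) (φ : (Fin r → S) →ₗ[S] (Fin s.rank → S)),
      (∀ j, ∀ v ∈ freeGrading k n deg j, φ v ∈ freeGrading k n s.deg j) ∧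
      LinearMap.range φ = s.syz ∧ LinearMap.ker φ ≤ MvPolynomial.idealOfVars (Fin n) k • ⊤ :=
  exists_minimal_cover (IsNoetherian.noetherian s.syz) s.isHomogeneous

/-- The minimal cover of the syzygies of a stage. -/
noncomputable def cover (s : SyzygyStage k n) :
    (Fin s.exists_cover.choose → S) →ₗ[S] (Fin s.rank → S) :=
  s.exists_cover.choose_spec.choose_spec.choose

/-- The source of the minimal cover together with its kernel. -/
noncomputable def next (s : SyzygyStage k n) : SyzygyStage k n where
  rank := s.exists_cover.choose
  deg := s.exists_cover.choose_spec.choose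
  syz := LinearMap.ker s.cover
  isHomogeneous := ker_isHomogeneous s.exists_cover.choose_spec.choose_spec.choose_spec.1
  le_smul_top := s.exists_cover.choose_spec.choose_spec.choose_spec.2.2

theorem cover_mem (s : SyzygyStage k n) :
    ∀ j, ∀ v ∈ freeGrading k n s.next.deg j, s.cover v ∈ freeGrading k n s.deg j :=
  s.exists_cover.choose_spec.choose_spec.choose_spec.1

theorem range_cover (s : SyzygyStage k n) : LinearMap.range s.cover = s.syz :=
  s.exists_cover.choose_spec.choose_spec.choose_spec.2.1

theorem exact_cover (s : SyzygyStage k n) : Function.Exact s.next.cover s.cover :=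
  fun v => (Iff.of_eq (congrArg (v ∈ ·) s.next.range_cover)).symm

/-- The stages reached from `s` by covering syzygies repeatedly. -/
noncomputable def iter (s : SyzygyStage k n) : ℕ → SyzygyStage k n
  | 0 => s
  | i + 1 => (s.iter i).next

end SyzygyStage

variable {M : Type u} [AddCommGroup M] [Module (MvPolynomial (Fin n) k) M] {𝓜 : ℤ → AddSubgroup M}
  [DirectSum.Decomposition 𝓜]

/-- The minimal graded free resolution extending a minimal graded free cover of `M`. -/
noncomputable def resolutionOfCover {r : ℕ} (deg : Fin r → ℤ) (φ : (Fin r → S) →ₗ[S] M)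
    (hφ : ∀ j, ∀ v ∈ freeGrading k n deg j, φ v ∈ 𝓜 j) (hsurj : Function.Surjective φ)
    (hker : LinearMap.ker φ ≤ MvPolynomial.idealOfVars (Fin n) k • ⊤) :
    MinimalGradedFreeResolution (k := k) (n := n) 𝓜 :=
  let s : SyzygyStage k n := ⟨r, deg, LinearMap.ker φ, ker_isHomogeneous hφ, hker⟩
  { rank := fun i => (s.iter i).rank
    deg := fun i => (s.iter i).deg
    d := fun i => (s.iter i).cover
    aug := φ
    d_mem := fun i => (s.iter i).cover_mem
    aug_mem := hφ
    aug_surjective := hsurj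
    exact_zero := fun v => (Iff.of_eq (congrArg (v ∈ ·) s.range_cover)).symm
    exact_succ := fun i => (s.iter i).exact_cover
    minimal := fun i => (s.iter i).range_cover.trans_le (s.iter i).le_smul_top }

theorem nonempty_minimalGradedFreeResolution [Module.Finite S M]
    [SetLike.GradedSMul (polyGrading k n) 𝓜] :
    Nonempty (MinimalGradedFreeResolution (k := k) (n := n) 𝓜) := by
  obtain ⟨r, deg, φ, hφ, hrange, hker⟩ := exists_minimal_cover (𝓜 := 𝓜) (K := (⊤ : Submodule S M))
    Module.Finite.fg_top fun _ _ _ => trivial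
  exact ⟨resolutionOfCover deg φ hφ (LinearMap.range_eq_top.1 hrange) hker⟩

end Existence

/-! ### Lifting along graded maps -/

section Lift

variable {k : Type u} [Field k] {n : ℕ}

local notation "S" => MvPolynomial (Fin n) k

theorem apply_eq_sum {r : ℕ} {N : Type*} [AddCommGroup N] [Module S N]
    (φ : (Fin r → S) →ₗ[S] N) (v : Fin r → S) : φ v = ∑ b, v b • φ (Pi.single b 1) := by
  conv_lhs => rw [pi_eq_sum_univ' v, map_sum]
  exact Finset.sum_congr rfl fun b _ => map_smul φ _ _

theorem exists_lift {r : ℕ} {G N : Type*} [AddCommGroup G] [Module S G] [AddCommGroup N]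
    [Module S N] (δ : G →ₗ[S] N) (θ : (Fin r → S) →ₗ[S] N) (h : ∀ v, θ v ∈ LinearMap.range δ) :
    ∃ φ : (Fin r → S) →ₗ[S] G, ∀ v, δ (φ v) = θ v := by
  choose g hg using fun a => h (Pi.single a 1)
  refine ⟨Fintype.linearCombination S g, fun v => ?_⟩
  rw [Fintype.linearCombination_apply, map_sum, apply_eq_sum θ]
  exact Finset.sum_congr rfl fun a _ => by rw [map_smul, hg]

theorem exists_graded_lift {r : ℕ} {deg : Fin r → ℤ} {G N : Type*} [AddCommGroup G] [Module S G]
    [AddCommGroup N] [Module S N] {𝓖 : ℤ → AddSubgroup G} {𝓝 : ℤ → AddSubgroup N}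
    [DirectSum.Decomposition 𝓖] [DirectSum.Decomposition 𝓝]
    [SetLike.GradedSMul (polyGrading k n) 𝓖] {δ : G →ₗ[S] N} (hδ : ∀ j, ∀ v ∈ 𝓖 j, δ v ∈ 𝓝 j)
    {θ : (Fin r → S) →ₗ[S] N} (hθ : ∀ j, ∀ v ∈ freeGrading k n deg j, θ v ∈ 𝓝 j)
    (h : ∀ v, θ v ∈ LinearMap.range δ) :
    ∃ φ : (Fin r → S) →ₗ[S] G, (∀ j, ∀ v ∈ freeGrading k n deg j, φ v ∈ 𝓖 j) ∧
      ∀ v, δ (φ v) = θ v := by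
  choose g hg using fun a => h (Pi.single a 1)
  refine ⟨Fintype.linearCombination S fun a => (DirectSum.decompose 𝓖 (g a) (deg a) : G),
    fun j v hv => linearCombination_mem (fun a => SetLike.coe_mem _) hv, fun v => ?_⟩
  rw [Fintype.linearCombination_apply, map_sum, apply_eq_sum θ]
  refine Finset.sum_congr rfl fun a _ => ?_
  have := decompose_map δ.toAddMonoidHom hδ (g a) (deg a)
  rw [LinearMap.toAddMonoidHom_coe, hg,
    DirectSum.decompose_of_mem_same _ (hθ _ _ (single_one_mem_freeGrading deg a))] at this
  rw [map_smul, this]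

end Lift

/-! ### Uniqueness of the graded shifts -/

namespace MinimalGradedFreeResolution

variable {k : Type u} [Field k] {n : ℕ} {M : Type u} [AddCommGroup M]
  [Module (MvPolynomial (Fin n) k) M] {𝓜 : ℤ → AddSubgroup M}

local notation "S" => MvPolynomial (Fin n) k

section Basic

variable (F : MinimalGradedFreeResolution (k := k) (n := n) 𝓜)

theorem d_d (i : ℕ) (v : Fin (F.rank (i + 2)) → S) : F.d i (F.d (i + 1) v) = 0 :=
  (F.exact_succ i _).2 ⟨v, rfl⟩

theorem mem_of_d_eq_zero (i : ℕ) {v : Fin (F.rank (i + 1)) → S} (hv : F.d i v = 0) (a) :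
    MvPolynomial.constantCoeff (v a) = 0 :=
  mem_idealOfVars_smul_top_iff.1 (F.minimal _ ((F.exact_succ i v).1 hv)) a

end Basic

section Uniqueness

variable [DirectSum.Decomposition 𝓜]

/-- Comparison maps between two minimal resolutions are inverse to each other modulo `𝔪`. The
partial homotopy `h` is what makes the induction on `i` work. -/
theorem exists_comparison (F G : MinimalGradedFreeResolution (k := k) (n := n) 𝓜) (i : ℕ) :
    ∃ (φ : (Fin (F.rank i) → S) →ₗ[S] (Fin (G.rank i) → S))
      (ψ : (Fin (G.rank i) → S) →ₗ[S] (Fin (F.rank i) → S))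
      (h : (Fin (F.rank i) → S) →ₗ[S] (Fin (F.rank (i + 1)) → S)),
      (∀ j, ∀ v ∈ freeGrading k n (F.deg i) j, φ v ∈ freeGrading k n (G.deg i) j) ∧
      (∀ v, φ (F.d i v) ∈ LinearMap.range (G.d i)) ∧
      (∀ v, ψ (G.d i v) ∈ LinearMap.range (F.d i)) ∧
      (∀ v, ψ (φ (F.d i v)) - F.d i v = F.d i (h (F.d i v))) ∧
      ∀ v, ψ (φ v) - v ∈ MvPolynomial.idealOfVars (Fin n) k •
        (⊤ : Submodule S (Fin (F.rank i) → S)) := by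
  induction i with
  | zero =>
    obtain ⟨φ, hφ, hφd⟩ := exists_graded_lift G.aug_mem F.aug_mem
      fun v => LinearMap.range_eq_top.2 G.aug_surjective ▸ trivial
    obtain ⟨ψ, hψd⟩ := exists_lift F.aug G.aug
      fun v => LinearMap.range_eq_top.2 F.aug_surjective ▸ trivial
    obtain ⟨h, hh⟩ := exists_lift (F.d 0) (ψ ∘ₗ φ - LinearMap.id)
      fun v => (F.exact_zero _).1 (by simp [hφd, hψd])
    refine ⟨φ, ψ, h, hφ, fun v => (G.exact_zero _).1 ?_, fun v => (F.exact_zero _).1 ?_,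
      fun v => (hh _).symm, fun v => F.minimal 0 ⟨h v, hh v⟩⟩
    · rw [hφd]
      exact (F.exact_zero _).2 ⟨v, rfl⟩
    · rw [hψd]
      exact (G.exact_zero _).2 ⟨v, rfl⟩
  | succ i ih =>
    obtain ⟨φ, ψ, h, hφ, hφr, hψr, hh, -⟩ := ih
    obtain ⟨φ', hφ', hφd⟩ := exists_graded_lift (G.d_mem i) (θ := φ ∘ₗ F.d i)
      (fun j v hv => hφ j _ (F.d_mem i j v hv)) hφr
    obtain ⟨ψ', hψd⟩ := exists_lift (F.d i) (ψ ∘ₗ G.d i) hψr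
    simp only [LinearMap.comp_apply] at hφd hψd
    obtain ⟨h', hh'⟩ := exists_lift (F.d (i + 1)) (ψ' ∘ₗ φ' - LinearMap.id - h ∘ₗ F.d i)
      fun v => (F.exact_succ i _).1 (by simp [hφd, hψd, hh])
    refine ⟨φ', ψ', h', hφ', fun v => (G.exact_succ i _).1 ?_, fun v => (F.exact_succ i _).1 ?_,
      fun v => ?_, fun v => ?_⟩
    · rw [hφd, d_d, map_zero]
    · rw [hψd, d_d, map_zero]
    · simp [hh', d_d]
    · have : ψ' (φ' v) - v = F.d (i + 1) (h' v) + h (F.d i v) := by simp [hh']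
      rw [this]
      refine add_mem (F.minimal _ ⟨_, rfl⟩) ?_
      have hm := Submodule.mem_map_of_mem (f := h) (F.minimal i ⟨v, rfl⟩)
      rw [Submodule.map_smul''] at hm
      exact Submodule.smul_mono le_rfl le_top hm

theorem exists_deg_eq (F G : MinimalGradedFreeResolution (k := k) (n := n) 𝓜) (i : ℕ)
    (a : Fin (F.rank i)) : ∃ b, G.deg i b = F.deg i a := by
  obtain ⟨φ, ψ, -, hφ, -, -, -, hm⟩ := exists_comparison F G i
  have h1 := mem_idealOfVars_smul_top_iff.1 (hm (Pi.single a 1)) a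
  have h2 : MvPolynomial.constantCoeff (ψ (φ (Pi.single a 1)) a) ≠ 0 := by
    intro h0
    simp [h0] at h1
  rw [apply_eq_sum ψ, Finset.sum_apply, map_sum] at h2
  obtain ⟨b, -, hb⟩ := Finset.exists_ne_zero_of_sum_ne_zero h2
  rw [Pi.smul_apply, smul_eq_mul, map_mul] at hb
  have := eq_zero_of_constantCoeff_ne_zero
    (mem_freeGrading.1 (hφ _ _ (single_one_mem_freeGrading (F.deg i) a)) b) (left_ne_zero_of_mul hb)
  exact ⟨b, by omega⟩

theorem gradedShifts_eq (F : MinimalGradedFreeResolution (k := k) (n := n) 𝓜) (i : ℕ) :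
    gradedShifts k n 𝓜 i = Set.range (F.deg i) := by
  refine Set.Subset.antisymm ?_ ?_
  · rintro _ ⟨G, a, rfl⟩
    exact exists_deg_eq G F i a
  · rintro _ ⟨a, rfl⟩
    exact ⟨F, a, rfl⟩

theorem isGreatest_maxShift (F : MinimalGradedFreeResolution (k := k) (n := n) 𝓜) {i : ℕ}
    (a : Fin (F.rank i)) : IsGreatest (gradedShifts k n 𝓜 i) (maxShift k n 𝓜 i) := by
  have hb : BddAbove (gradedShifts k n 𝓜 i) :=
    F.gradedShifts_eq i ▸ (Set.finite_range _).bddAbove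
  exact ⟨Int.csSup_mem ⟨_, F, a, rfl⟩ hb, fun _ h => le_csSup hb h⟩

theorem isLeast_minShift (F : MinimalGradedFreeResolution (k := k) (n := n) 𝓜) {i : ℕ}
    (a : Fin (F.rank i)) : IsLeast (gradedShifts k n 𝓜 i) (minShift k n 𝓜 i) := by
  have hb : BddBelow (gradedShifts k n 𝓜 i) :=
    F.gradedShifts_eq i ▸ (Set.finite_range _).bddBelow
  exact ⟨Int.csInf_mem ⟨_, F, a, rfl⟩ hb, fun _ h => csInf_le hb h⟩

end Uniqueness

/-! ### The homotopy for multiplication by an annihilating form -/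

variable (F : MinimalGradedFreeResolution (k := k) (n := n) 𝓜)

/-- Multiplication by `f ∈ Ann M` is null-homotopic on a resolution of `M`. The map `s` is the
`i`-th component of a homotopy of degree `d`; the stated identity on boundaries is what remains
of the homotopy relation there. -/
theorem exists_homotopy {f : S} {d : ℕ} (hf : f ∈ Module.annihilator S M)
    (hd : f.IsHomogeneous d) (i : ℕ) :
    ∃ s : (Fin (F.rank i) → S) →ₗ[S] (Fin (F.rank (i + 1)) → S),
      (∀ j, ∀ v ∈ freeGrading k n (fun a => F.deg i a + d) j,
        s v ∈ freeGrading k n (F.deg (i + 1)) j) ∧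
      ∀ v, F.d i (s (F.d i v)) = f • F.d i v := by
  have hsmul : ∀ (i : ℕ) (j : ℤ), ∀ v ∈ freeGrading k n (fun a => F.deg i a + d) j,
      f • v ∈ freeGrading k n (F.deg i) j := by
    intro i j v hv
    rw [mem_freeGrading] at hv ⊢
    intro a
    have := mul_mem_polyGrading (mem_polyGrading_natCast.2 hd) (hv a)
    rwa [show (d : ℤ) + (j - (F.deg i a + d)) = j - F.deg i a by ring] at this
  induction i with
  | zero =>
    obtain ⟨s, hs, hsd⟩ := exists_graded_lift (F.d_mem 0) (θ := f • LinearMap.id) (hsmul 0)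
      fun v => (F.exact_zero _).1 (by simp [Module.mem_annihilator.1 hf])
    exact ⟨s, hs, fun v => hsd _⟩
  | succ i ih =>
    obtain ⟨s, hs, hsd⟩ := ih
    let θ : (Fin (F.rank (i + 1)) → S) →ₗ[S] (Fin (F.rank (i + 1)) → S) :=
      f • LinearMap.id - s ∘ₗ F.d i
    have hθ : ∀ j, ∀ v ∈ freeGrading k n (fun a => F.deg (i + 1) a + d) j,
        θ v ∈ freeGrading k n (F.deg (i + 1)) j := by
      refine fun j v hv => sub_mem (hsmul _ _ _ hv) (hs _ _ ?_)
      have hv' : v ∈ freeGrading k n (F.deg (i + 1)) (j - d) := by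
        rw [mem_freeGrading] at hv ⊢
        exact fun a => by simpa only [sub_sub, add_comm (d : ℤ)] using hv a
      have := F.d_mem i _ _ hv'
      rw [mem_freeGrading] at this ⊢
      exact fun a => by simpa only [sub_sub, add_comm (d : ℤ)] using this a
    obtain ⟨s', hs', hsd'⟩ := exists_graded_lift (F.d_mem (i + 1)) hθ
      fun v => (F.exact_succ i _).1 (by simp [θ, hsd])
    exact ⟨s', hs', fun v => by simp [θ, hsd', d_d]⟩

/-- If `F (q + 1)` is the last term of the resolution, the homotopy `s` satisfies `s ∘ d = f` on
it, so the coefficient of a basis element `e` in `s (d e)` is `f ≠ 0`; comparing degrees bounds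
the degree of `e`. -/
theorem exists_deg_le {f : S} {d : ℕ} (hf : f ∈ Module.annihilator S M) (hf0 : f ≠ 0)
    (hd : f.IsHomogeneous d) {q : ℕ} (hq : Function.Injective (F.d q)) (a : Fin (F.rank (q + 1))) :
    ∃ b, F.deg (q + 1) a ≤ F.deg q b + d := by
  obtain ⟨s, hs, hsd⟩ := F.exists_homotopy hf hd q
  have h1 : s (F.d q (Pi.single a 1)) = f • Pi.single a 1 := hq (by rw [hsd, map_smul])
  have h2 : s (F.d q (Pi.single a 1)) a ≠ 0 := by simpa [h1] using hf0
  rw [apply_eq_sum s, Finset.sum_apply] at h2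
  obtain ⟨b, -, hb⟩ := Finset.exists_ne_zero_of_sum_ne_zero h2
  rw [Pi.smul_apply, smul_eq_mul] at hb
  have h3 := mem_freeGrading.1
    (hs _ _ (single_one_mem_freeGrading (fun a => F.deg q a + d) b)) a
  refine ⟨b, ?_⟩
  by_contra hlt
  exact right_ne_zero_of_mul hb (eq_zero_of_mem_polyGrading_neg (by omega) h3)

end MinimalGradedFreeResolution

/-! ### Projective dimension and the length of a minimal resolution -/

/-- Dimension shifting along a surjection, upwards. -/
theorem hasProjectiveDimensionLT_of_ker {R : Type u} [CommRing R] {F N : Type u} [AddCommGroup F]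
    [Module R F] [Module.Projective R F] [AddCommGroup N] [Module R N] {φ : F →ₗ[R] N}
    (hφ : Function.Surjective φ) {m : ℕ}
    (h : HasProjectiveDimensionLT (ModuleCat.of R (LinearMap.ker φ)) m) :
    HasProjectiveDimensionLT (ModuleCat.of R N) (m + 1) := by
  have hF : Projective (ModuleCat.of R F) := (IsProjective.iff_projective F).1 inferInstance
  exact (LinearMap.shortExact_shortComplexKer hφ).hasProjectiveDimensionLT_X₃ m h
    (hasProjectiveDimensionLT_of_ge (ModuleCat.of R F) 1 (m + 1) (by omega))

/-- Dimension shifting along a surjection, downwards. -/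
theorem hasProjectiveDimensionLT_ker {R : Type u} [CommRing R] {F N : Type u} [AddCommGroup F]
    [Module R F] [Module.Projective R F] [AddCommGroup N] [Module R N] {φ : F →ₗ[R] N}
    (hφ : Function.Surjective φ) {m : ℕ}
    (h : HasProjectiveDimensionLT (ModuleCat.of R N) (m + 2)) :
    HasProjectiveDimensionLT (ModuleCat.of R (LinearMap.ker φ)) (m + 1) := by
  have hF : Projective (ModuleCat.of R F) := (IsProjective.iff_projective F).1 inferInstance
  exact ((LinearMap.shortExact_shortComplexKer hφ).hasProjectiveDimensionLT_X₃_iff m hF).1 h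

namespace MinimalGradedFreeResolution

variable {k : Type u} [Field k] {n : ℕ} {M : Type u} [AddCommGroup M]
  [Module (MvPolynomial (Fin n) k) M] {𝓜 : ℤ → AddSubgroup M}

local notation "S" => MvPolynomial (Fin n) k

variable (F : MinimalGradedFreeResolution (k := k) (n := n) 𝓜)

theorem ker_aug : LinearMap.ker F.aug = LinearMap.range (F.d 0) :=
  LinearMap.exact_iff.1 F.exact_zero

theorem ker_rangeRestrict_d (i : ℕ) :
    LinearMap.ker (F.d i).rangeRestrict = LinearMap.range (F.d (i + 1)) :=
  (LinearMap.ker_rangeRestrict _).trans (LinearMap.exact_iff.1 (F.exact_succ i))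

theorem hasProjectiveDimensionLT_of_range (i : ℕ) {m : ℕ}
    (h : HasProjectiveDimensionLT (ModuleCat.of S (LinearMap.range (F.d i))) m) :
    HasProjectiveDimensionLT (ModuleCat.of S M) (m + i + 1) := by
  induction i generalizing m with
  | zero => exact hasProjectiveDimensionLT_of_ker F.aug_surjective (by rwa [ker_aug])
  | succ i ih =>
    have := ih (hasProjectiveDimensionLT_of_ker (F.d i).surjective_rangeRestrict
      (by rwa [ker_rangeRestrict_d]))
    rwa [show m + (i + 1) + 1 = m + 1 + i + 1 by ring]

theorem hasProjectiveDimensionLT_range (i : ℕ) {m : ℕ}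
    (h : HasProjectiveDimensionLT (ModuleCat.of S M) (m + i + 2)) :
    HasProjectiveDimensionLT (ModuleCat.of S (LinearMap.range (F.d i))) (m + 1) := by
  induction i generalizing m with
  | zero =>
    have := hasProjectiveDimensionLT_ker F.aug_surjective h
    rwa [ker_aug] at this
  | succ i ih =>
    have := hasProjectiveDimensionLT_ker (F.d i).surjective_rangeRestrict
      (ih (m := m + 1) (by rwa [show m + 1 + i + 2 = m + (i + 1) + 2 by ring]))
    rwa [ker_rangeRestrict_d] at this

/-- A minimal cover of a projective module is injective: its kernel `N` is a direct summand
contained in `𝔪 F`, so `N = 𝔪 N`, and Nakayama's lemma gives an element of `1 + 𝔪` killing `N`,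
which is torsion-free. -/
theorem d_injective_of_projective (q : ℕ) [Module.Projective S (LinearMap.range (F.d q))] :
    Function.Injective (F.d q) := by
  obtain ⟨σ, hσ⟩ := Module.projective_lifting_property (F.d q).rangeRestrict LinearMap.id
    (F.d q).surjective_rangeRestrict
  have hσ' : ∀ x, F.d q (σ x) = x := fun x => congrArg Subtype.val (LinearMap.congr_fun hσ x)
  let ρ : (Fin (F.rank (q + 1)) → S) →ₗ[S] (Fin (F.rank (q + 1)) → S) :=
    LinearMap.id - σ ∘ₗ (F.d q).rangeRestrict
  have hρ : ∀ v, ρ v = v - σ ((F.d q).rangeRestrict v) := fun v => rfl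
  have hρN : ⊤ ≤ (LinearMap.ker (F.d q)).comap ρ := by
    intro v _
    rw [Submodule.mem_comap, LinearMap.mem_ker, hρ, map_sub, hσ']
    exact sub_self _
  have hN : LinearMap.ker (F.d q) ≤
      MvPolynomial.idealOfVars (Fin n) k • LinearMap.ker (F.d q) := by
    intro v hv
    have hvm : v ∈ MvPolynomial.idealOfVars (Fin n) k •
        (⊤ : Submodule S (Fin (F.rank (q + 1)) → S)) := F.minimal _ ((F.exact_succ q v).1 hv)
    have h := Submodule.mem_map_of_mem (f := ρ) hvm
    rw [Submodule.map_smul''] at h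
    have hρv : ρ v = v := by
      have h0 : (F.d q).rangeRestrict v = 0 := Subtype.ext hv
      rw [hρ, h0, map_zero, sub_zero]
    rw [← hρv]
    exact Submodule.smul_mono le_rfl (Submodule.map_le_iff_le_comap.2 hρN) h
  obtain ⟨r, hr, hr0⟩ := Submodule.exists_sub_one_mem_and_smul_eq_zero_of_fg_of_le_smul _ _
    (IsNoetherian.noetherian _) hN
  have hr' : r ≠ 0 := by
    rintro rfl
    rw [mem_idealOfVars_iff] at hr
    simp at hr
  exact (injective_iff_map_eq_zero _).2 fun v hv => (smul_eq_zero.1 (hr0 v hv)).resolve_left hr'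

theorem rank_pos_of_projectiveDimension {q : ℕ} (hp : projectiveDimension (ModuleCat.of S M) =
    (((q + 1 : ℕ) : ℕ∞) : WithBot ℕ∞)) : 0 < F.rank (q + 1) := by
  by_contra h0
  have : IsEmpty (Fin (F.rank (q + 1))) := ⟨fun a => h0 a.pos⟩
  have hs : Subsingleton (LinearMap.range (F.d q)) :=
    (F.d q).surjective_rangeRestrict.subsingleton
  have h := F.hasProjectiveDimensionLT_of_range q (m := 0)
    (Limits.IsZero.hasProjectiveDimensionLT_zero (ModuleCat.isZero_of_subsingleton _))
  rw [zero_add, ← projectiveDimension_lt_iff, hp] at h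
  exact lt_irrefl _ h

theorem d_injective_of_projectiveDimension {q : ℕ}
    (hp : projectiveDimension (ModuleCat.of S M) = (((q + 1 : ℕ) : ℕ∞) : WithBot ℕ∞)) :
    Function.Injective (F.d q) := by
  have h : HasProjectiveDimensionLT (ModuleCat.of S M) (0 + q + 2) :=
    (projectiveDimension_le_iff _ (q + 1)).1 hp.le |> fun h => by
      rwa [show 0 + q + 2 = q + 1 + 1 by ring]
  have h1 := F.hasProjectiveDimensionLT_range q h
  rw [zero_add, ← projective_iff_hasProjectiveDimensionLT_one,
    ← IsProjective.iff_projective] at h1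
  exact F.d_injective_of_projective q

end MinimalGradedFreeResolution

section Bound

variable {k : Type u} [Field k] {n : ℕ} {M : Type u} [AddCommGroup M]
  [Module (MvPolynomial (Fin n) k) M]

local notation "S" => MvPolynomial (Fin n) k

theorem nontrivial_of_projectiveDimension {p : ℕ}
    (hp : projectiveDimension (ModuleCat.of S M) = ((p : ℕ∞) : WithBot ℕ∞)) : Nontrivial M := by
  by_contra h
  rw [not_nontrivial_iff_subsingleton] at h
  have : projectiveDimension (ModuleCat.of S M) = ⊥ :=
    (projectiveDimension_eq_bot_iff _).2 (ModuleCat.isZero_of_subsingleton _)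
  rw [hp] at this
  exact WithBot.coe_ne_bot this

/-- A nonzero module with nonzero annihilator is not projective, since projective modules over a
domain are torsion-free. -/
theorem one_le_of_projectiveDimension {p : ℕ}
    (hp : projectiveDimension (ModuleCat.of S M) = ((p : ℕ∞) : WithBot ℕ∞)) {f : S}
    (hf : f ∈ Module.annihilator S M) (hf0 : f ≠ 0) : 1 ≤ p := by
  by_contra h
  obtain rfl : p = 0 := by omega
  have hproj : Module.Projective S M := by
    rw [IsProjective.iff_projective, projective_iff_hasProjectiveDimensionLT_one,
      ← zero_add 1]
    exact (projectiveDimension_le_iff (ModuleCat.of S M) 0).1 hp.le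
  obtain ⟨s, hs⟩ := hproj
  have := nontrivial_of_projectiveDimension hp
  obtain ⟨x, hx⟩ := exists_ne (0 : M)
  have h0 : f • s x = 0 := by rw [← map_smul, Module.mem_annihilator.1 hf, map_zero]
  exact hx (by rw [← hs x, (smul_eq_zero.1 h0).resolve_left hf0, map_zero])

/-- The bound on the maximal shifts at the end of the resolution, for a module annihilated by a
form of degree `d`. -/
theorem maxShift_le_of_annihilator [Module.Finite S M] {𝓜 : ℤ → AddSubgroup M}
    [DirectSum.Decomposition 𝓜] [SetLike.GradedSMul (polyGrading k n) 𝓜] {p : ℕ}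
    (hp : projectiveDimension (ModuleCat.of S M) = ((p : ℕ∞) : WithBot ℕ∞)) {f : S} {d : ℕ}
    (hf : f ∈ Module.annihilator S M) (hf0 : f ≠ 0) (hd : f.IsHomogeneous d) :
    1 ≤ p ∧ IsGreatest (gradedShifts k n 𝓜 p) (maxShift k n 𝓜 p) ∧
      IsGreatest (gradedShifts k n 𝓜 (p - 1)) (maxShift k n 𝓜 (p - 1)) ∧
      maxShift k n 𝓜 p ≤ maxShift k n 𝓜 (p - 1) + d := by
  have hp1 := one_le_of_projectiveDimension hp hf hf0
  obtain ⟨q, rfl⟩ : ∃ q, p = q + 1 := ⟨p - 1, by omega⟩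
  rw [Nat.add_sub_cancel]
  obtain ⟨F⟩ := nonempty_minimalGradedFreeResolution (k := k) (n := n) (𝓜 := 𝓜)
  have hbound := F.exists_deg_le hf hf0 hd (F.d_injective_of_projectiveDimension hp)
  have hg := F.isGreatest_maxShift ⟨0, F.rank_pos_of_projectiveDimension hp⟩
  obtain ⟨a, ha⟩ := F.gradedShifts_eq (q + 1) ▸ hg.1
  obtain ⟨b, hb⟩ := hbound a
  have hg' := F.isGreatest_maxShift b
  have := hg'.2 ⟨F, b, rfl⟩
  exact ⟨hp1, hg, hg', by omega⟩

end Bound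

/-! ### Cyclic modules -/

section Cyclic

variable {k : Type u} [Field k] {n : ℕ}

local notation "S" => MvPolynomial (Fin n) k

theorem constantCoeff_eq_zero_of_mem {I : Ideal S}
    (hI : I.IsHomogeneous (MvPolynomial.homogeneousSubmodule (Fin n) k)) (hI1 : I ≠ ⊤) {f : S}
    (hf : f ∈ I) : MvPolynomial.constantCoeff f = 0 := by
  by_contra h
  have h0 := MvPolynomial.homogeneousComponent_mem_of_mem hI hf 0
  rw [MvPolynomial.homogeneousComponent_zero] at h0
  exact hI1 (Ideal.eq_top_of_isUnit_mem _ h0 ((isUnit_iff_ne_zero.2 h).map MvPolynomial.C))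

/-- A proper homogeneous ideal `I` has a minimal graded free cover `θ` by the first term of a
minimal graded free resolution of `S ⧸ I`. -/
theorem exists_resolution_quotient {I : Ideal S}
    (hI : I.IsHomogeneous (MvPolynomial.homogeneousSubmodule (Fin n) k)) (hI1 : I ≠ ⊤)
    [DirectSum.Decomposition (quotientGrading I)] :
    ∃ (F : MinimalGradedFreeResolution (k := k) (n := n) (quotientGrading I))
      (θ : (Fin (F.rank 1) → S) →ₗ[S] S),
      (∀ j, ∀ v ∈ freeGrading k n (F.deg 1) j, θ v ∈ polyGrading k n j) ∧
      LinearMap.range θ = I ∧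
      ∀ v, θ v = 0 → ∀ a, MvPolynomial.constantCoeff (v a) = 0 := by
  let φ : (Fin 1 → S) →ₗ[S] S ⧸ I := I.mkQ ∘ₗ LinearMap.proj 0
  have hφ : ∀ v, φ v = 0 ↔ v 0 ∈ I := fun v => Ideal.Quotient.eq_zero_iff_mem
  let F : MinimalGradedFreeResolution (k := k) (n := n) (quotientGrading I) :=
    resolutionOfCover (fun _ => 0) φ
      (fun j v hv => ⟨v 0, by simpa using mem_freeGrading.1 hv 0, rfl⟩)
      (fun x => by
        obtain ⟨f, rfl⟩ := Ideal.Quotient.mk_surjective x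
        exact ⟨fun _ => f, rfl⟩)
      (fun v hv => by
        rw [mem_idealOfVars_smul_top_iff]
        intro a
        rw [Subsingleton.elim a 0]
        exact constantCoeff_eq_zero_of_mem hI hI1 ((hφ v).1 hv))
  let d₀ : (Fin (F.rank 1) → S) →ₗ[S] (Fin 1 → S) := F.d 0
  have hd₀ : ∀ w : Fin 1 → S, w 0 ∈ I ↔ w ∈ LinearMap.range d₀ :=
    fun w => (hφ w).symm.trans (F.exact_zero w)
  refine ⟨F, LinearMap.proj 0 ∘ₗ d₀, fun j v hv => ?_, le_antisymm ?_ fun f hf => ?_,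
    fun v hv => F.mem_of_d_eq_zero 0 (?_ : d₀ v = 0)⟩
  · have : d₀ v ∈ freeGrading k n (fun _ : Fin 1 => 0) j := F.d_mem 0 j v hv
    simpa using mem_freeGrading.1 this 0
  · rintro _ ⟨v, rfl⟩
    exact (hd₀ _).2 ⟨v, rfl⟩
  · obtain ⟨v, hv⟩ := (hd₀ fun _ => f).1 hf
    exact ⟨v, congrFun hv 0⟩
  · ext1 a
    rw [Subsingleton.elim a 0]
    exact hv

theorem isHomogeneous_span_singleton {f : S} {d : ℕ} (hd : f.IsHomogeneous d) :
    (Ideal.span {f}).IsHomogeneous (MvPolynomial.homogeneousSubmodule (Fin n) k) :=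
  Ideal.homogeneous_span _ _ fun x hx => ⟨d, by rw [Set.mem_singleton_iff.1 hx]; exact hd⟩

/-- The only shift in homological degree one for a hypersurface ring is the degree of its
equation. -/
theorem gradedShifts_span_singleton {f : S} {d : ℕ} (hf0 : f ≠ 0) (hd : f.IsHomogeneous d)
    (h1 : Ideal.span {f} ≠ ⊤) :
    gradedShifts k n (quotientGrading (Ideal.span {f})) 1 = {(d : ℤ)} := by
  let _ := (quotientGrading_isInternal (isHomogeneous_span_singleton hd)).chooseDecomposition
  let _ := (polyGrading_isInternal (k := k) (n := n)).chooseDecomposition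
  obtain ⟨F, θ, hθ, hrange, hker⟩ := exists_resolution_quotient (isHomogeneous_span_singleton hd) h1
  rw [F.gradedShifts_eq]
  obtain ⟨v, hv⟩ : f ∈ LinearMap.range θ := hrange.ge (Ideal.mem_span_singleton_self f)
  -- a preimage `w` of `f` that is homogeneous of degree `d`
  obtain ⟨w, hw, hwf⟩ : ∃ w ∈ freeGrading k n (F.deg 1) d, θ w = f := by
    refine ⟨_, SetLike.coe_mem (DirectSum.decompose (freeGrading k n (F.deg 1)) v (d : ℤ)), ?_⟩
    have := decompose_map θ.toAddMonoidHom hθ v d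
    rw [LinearMap.toAddMonoidHom_coe, hv,
      DirectSum.decompose_of_mem_same _ (mem_polyGrading_natCast.2 hd)] at this
    exact this.symm
  have hdeg : ∀ a, F.deg 1 a = d := by
    intro a
    obtain ⟨g, hg⟩ := Ideal.mem_span_singleton'.1 (hrange.le ⟨Pi.single a 1, rfl⟩)
    -- `e_a - g • w` is a relation, so its coefficient `1 - g * w a` lies in `𝔪`
    have h := hker (Pi.single a 1 - g • w)
      (by rw [map_sub, map_smul, hwf, smul_eq_mul, hg, sub_self]) a
    have hwa : MvPolynomial.constantCoeff (w a) ≠ 0 := by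
      intro h0
      simp [h0] at h
    have := eq_zero_of_constantCoeff_ne_zero (mem_freeGrading.1 hw a) hwa
    omega
  have hne : Nonempty (Fin (F.rank 1)) := by
    by_contra hempty
    rw [not_nonempty_iff] at hempty
    exact hf0 (by rw [← hwf, Subsingleton.elim w 0, map_zero])
  rw [funext hdeg]
  exact Set.range_const

/-- The initial degree of `I` is attained by a nonzero form in `I`. -/
theorem exists_form_of_minShift {I : Ideal S}
    (hI : I.IsHomogeneous (MvPolynomial.homogeneousSubmodule (Fin n) k)) (hI0 : I ≠ ⊥)
    (hI1 : I ≠ ⊤) :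
    IsLeast (gradedShifts k n (quotientGrading I) 1) (minShift k n (quotientGrading I) 1) ∧
      ∃ (f : S) (d : ℕ), f ∈ I ∧ f ≠ 0 ∧ f.IsHomogeneous d ∧
        minShift k n (quotientGrading I) 1 = d := by
  let _ := (quotientGrading_isInternal hI).chooseDecomposition
  obtain ⟨F, θ, hθ, hrange, hker⟩ := exists_resolution_quotient hI hI1
  have hne : Nonempty (Fin (F.rank 1)) := by
    by_contra hempty
    rw [not_nonempty_iff] at hempty
    refine hI0 ((Submodule.eq_bot_iff _).2 fun f hf => ?_)
    obtain ⟨v, rfl⟩ : f ∈ LinearMap.range θ := hrange.ge hf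
    rw [Subsingleton.elim v 0, map_zero]
  have hleast := F.isLeast_minShift hne.some
  refine ⟨hleast, ?_⟩
  obtain ⟨a, ha⟩ := F.gradedShifts_eq 1 ▸ hleast.1
  have hmem := hθ _ _ (single_one_mem_freeGrading (F.deg 1) a)
  have hf0 : θ (Pi.single a 1) ≠ 0 := fun h0 => by simpa using hker _ h0 a
  have hnn : 0 ≤ F.deg 1 a := by
    by_contra hlt
    exact hf0 (eq_zero_of_mem_polyGrading_neg (not_le.1 hlt) hmem)
  obtain ⟨d, hd⟩ := Int.eq_ofNat_of_zero_le hnn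
  rw [hd] at hmem
  exact ⟨_, d, hrange.le ⟨_, rfl⟩, hf0, hmem, ha.symm.trans hd⟩

end Cyclic

end GradedSyzygies

theorem mainTheorem3 (k : Type u) [Field k] (n : ℕ) :
    (∀ (M : Type u) [AddCommGroup M] [Module (MvPolynomial (Fin n) k) M]
        [Module.Finite (MvPolynomial (Fin n) k) M] (𝓜 : ℤ → AddSubgroup M)
        [SetLike.GradedSMul (GradedSyzygies.polyGrading k n) 𝓜],
      DirectSum.IsInternal 𝓜 →
      ∀ p : ℕ,
        projectiveDimension (ModuleCat.of (MvPolynomial (Fin n) k) M) = ((p : ℕ∞) : WithBot ℕ∞) →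
      ∀ (f : MvPolynomial (Fin n) k) (d : ℕ),
        f ∈ Module.annihilator (MvPolynomial (Fin n) k) M → f ≠ 0 → f.IsHomogeneous d →
        1 ≤ p ∧
        IsGreatest (GradedSyzygies.gradedShifts k n 𝓜 p) (GradedSyzygies.maxShift k n 𝓜 p) ∧
        IsGreatest (GradedSyzygies.gradedShifts k n 𝓜 (p - 1))
          (GradedSyzygies.maxShift k n 𝓜 (p - 1)) ∧
        IsGreatest
          (GradedSyzygies.gradedShifts k n (GradedSyzygies.quotientGrading (Ideal.span {f})) 1)
          (GradedSyzygies.maxShift k n (GradedSyzygies.quotientGrading (Ideal.span {f})) 1) ∧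
        GradedSyzygies.maxShift k n 𝓜 p ≤ GradedSyzygies.maxShift k n 𝓜 (p - 1) + (d : ℤ) ∧
        GradedSyzygies.maxShift k n 𝓜 (p - 1) + (d : ℤ) =
          GradedSyzygies.maxShift k n 𝓜 (p - 1) +
            GradedSyzygies.maxShift k n (GradedSyzygies.quotientGrading (Ideal.span {f})) 1) ∧
    (∀ I : Ideal (MvPolynomial (Fin n) k),
      I.IsHomogeneous (MvPolynomial.homogeneousSubmodule (Fin n) k) → I ≠ ⊥ →
      ∀ p : ℕ,
        projectiveDimension (ModuleCat.of (MvPolynomial (Fin n) k) (MvPolynomial (Fin n) k ⧸ I)) =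
          ((p : ℕ∞) : WithBot ℕ∞) →
        1 ≤ p ∧
        IsGreatest (GradedSyzygies.gradedShifts k n (GradedSyzygies.quotientGrading I) p)
          (GradedSyzygies.maxShift k n (GradedSyzygies.quotientGrading I) p) ∧
        IsGreatest (GradedSyzygies.gradedShifts k n (GradedSyzygies.quotientGrading I) (p - 1))
          (GradedSyzygies.maxShift k n (GradedSyzygies.quotientGrading I) (p - 1)) ∧
        IsLeast (GradedSyzygies.gradedShifts k n (GradedSyzygies.quotientGrading I) 1)
          (GradedSyzygies.minShift k n (GradedSyzygies.quotientGrading I) 1) ∧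
        GradedSyzygies.maxShift k n (GradedSyzygies.quotientGrading I) p ≤
          GradedSyzygies.maxShift k n (GradedSyzygies.quotientGrading I) (p - 1) +
            GradedSyzygies.minShift k n (GradedSyzygies.quotientGrading I) 1) := by
  refine ⟨fun M _ _ _ 𝓜 _ hM p hp f d hf hf0 hd => ?_, fun I hI hI0 p hp => ?_⟩
  · let _ := hM.chooseDecomposition
    obtain ⟨hp1, hT, hT', hle⟩ :=
      GradedSyzygies.maxShift_le_of_annihilator (𝓜 := 𝓜) hp hf hf0 hd
    have := GradedSyzygies.nontrivial_of_projectiveDimension hp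
    have h1 : Ideal.span {f} ≠ ⊤ := fun h => by
      rw [Ideal.span_singleton_eq_top] at h
      obtain ⟨x, hx⟩ := exists_ne (0 : M)
      exact hx (h.smul_eq_zero.1 (Module.mem_annihilator.1 hf x))
    have hshift := GradedSyzygies.gradedShifts_span_singleton hf0 hd h1
    have hmax : GradedSyzygies.maxShift k n
        (GradedSyzygies.quotientGrading (Ideal.span {f})) 1 = d := by
      rw [GradedSyzygies.maxShift, hshift, csSup_singleton]
    exact ⟨hp1, hT, hT', by rw [hmax, hshift]; exact isGreatest_singleton, hle, by rw [hmax]⟩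
  · let _ := (GradedSyzygies.quotientGrading_isInternal hI).chooseDecomposition
    have hI1 : I ≠ ⊤ := Ideal.Quotient.nontrivial_iff.1
      (GradedSyzygies.nontrivial_of_projectiveDimension hp)
    obtain ⟨hmin, f, d, hfI, hf0, hd, ht⟩ := GradedSyzygies.exists_form_of_minShift hI hI0 hI1
    obtain ⟨hp1, hT, hT', hle⟩ := GradedSyzygies.maxShift_le_of_annihilator
      (𝓜 := GradedSyzygies.quotientGrading I) hp (by rwa [Ideal.annihilator_quotient]) hf0 hd
    exact ⟨hp1, hT, hT', hmin, ht ▸ hle⟩
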